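/- Let $p,q,m$ be non-negative integers with $\gcd(p,q,m)=1$, and let $G$ and $H$ be finite abelian groups of orders $|G|=q+m$ and $|H|=p+m$. Let $\mathcal R=\mathbb C[G]$ and $\tilde{\mathcal R}=\mathbb C[H]$ be the regular representations of $G$ and $H$ over $\mathbb C$. For a finite-dimensional complex representation $V$ of a group $K$, let $\mathcal S^n(V)$ denote the homogeneous component of degree $n$ of the symmetric algebra of $V$ and $\wedge^n(V)$ the $n$-th exterior power of $V$, with the induced actions of $K$; let $K$ act diagonally on $\mathcal S^a(V)\otimes\wedge^b(V)$, and let $\big(\mathcal S^a(V)\otimes\wedge^b(V)\big)_K$ be the subspace of $K$-invariants (the isotypic component of the trivial representation). Then $$\dim_{\mathbb C}\big(\mathcal S^p(\mathcal R)\otimes\wedge^m(\mathcal R)\big)_{G}=\dim_{\mathbb C}\big(\mathcal S^q(\tilde{\mathcal R})\otimes\wedge^m(\tilde{\mathcal R})\big)_{H},$$ and both dimensions are equal to $$\frac{1}{p+q+m}\binom{p+q+m}{p,q,m}=\frac{1}{p+q+m}\cdot\frac{(p+q+m)!}{p!\,q!\,m!}.$$ -/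

import Mathlib

open scoped TensorProduct

/-- Functoriality of the symmetric algebra: the algebra map
`S(M) → S(N)` extending a linear map `f : M → N`. -/
noncomputable def symAlgMap {k M N : Type*} [CommRing k] [AddCommGroup M] [Module k M]
    [AddCommGroup N] [Module k N] (f : M →ₗ[k] N) :
    SymmetricAlgebra k M →ₐ[k] SymmetricAlgebra k N :=
  SymmetricAlgebra.lift (SymmetricAlgebra.ι k N ∘ₗ f)

/-- The symmetric power `S^n(M)`: the homogeneous component of degree `n` of the symmetric
algebra `S(M)`, spanned by the products of `n` elements of `M`. (Mathlib defines the exterior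
power `⋀[k]^n M` inside the exterior algebra in the same way.) -/
abbrev symPow (k : Type*) [CommRing k] (n : ℕ) (M : Type*) [AddCommGroup M] [Module k M] :
    Submodule k (SymmetricAlgebra k M) :=
  LinearMap.range (SymmetricAlgebra.ι k M) ^ n

theorem symAlgMap_mem_symPow {k M N : Type*} [CommRing k] [AddCommGroup M] [Module k M]
    [AddCommGroup N] [Module k N] (f : M →ₗ[k] N) (n : ℕ) (x : SymmetricAlgebra k M)
    (hx : x ∈ symPow k n M) : symAlgMap f x ∈ symPow k n N := by
  have h1 : (LinearMap.range (SymmetricAlgebra.ι k M)).map (symAlgMap f).toLinearMap ≤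
      LinearMap.range (SymmetricAlgebra.ι k N) := by
    rintro _ ⟨_, ⟨v, rfl⟩, rfl⟩
    exact ⟨f v, by simp [symAlgMap]⟩
  have h2 : (symPow k n M).map (symAlgMap f).toLinearMap ≤ symPow k n N := by
    rw [Submodule.map_pow]
    exact pow_le_pow_left' h1 n
  exact h2 (Submodule.mem_map_of_mem hx)

theorem symAlgMap_id {k M : Type*} [CommRing k] [AddCommGroup M] [Module k M] :
    symAlgMap (LinearMap.id : M →ₗ[k] M) = AlgHom.id k (SymmetricAlgebra k M) := by
  ext x
  simp [symAlgMap]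

theorem symAlgMap_comp {k M N P : Type*} [CommRing k] [AddCommGroup M] [Module k M]
    [AddCommGroup N] [Module k N] [AddCommGroup P] [Module k P]
    (f : N →ₗ[k] P) (g : M →ₗ[k] N) :
    symAlgMap (f ∘ₗ g) = (symAlgMap f).comp (symAlgMap g) := by
  ext x
  simp [symAlgMap]

namespace Representation

variable {k G V : Type*} [CommRing k] [Monoid G] [AddCommGroup V] [Module k V]

/-- The representation of `G` on `S^n(V)` induced by a representation `ρ` on `V`:
`g • (v₁ ⋯ vₙ) = (g • v₁) ⋯ (g • vₙ)`. -/
noncomputable def symPower (ρ : Representation k G V) (n : ℕ) :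
    Representation k G (symPow k n V) where
  toFun g := (symAlgMap (ρ g)).toLinearMap.restrict (symAlgMap_mem_symPow (ρ g) n)
  map_one' := by
    ext x
    simp [Module.End.one_eq_id, symAlgMap_id]
  map_mul' g h := by
    ext x
    have h1 : symAlgMap (ρ (g * h)) = (symAlgMap (ρ g)).comp (symAlgMap (ρ h)) := by
      rw [map_mul, Module.End.mul_eq_comp, symAlgMap_comp]
    exact congrArg (fun F : SymmetricAlgebra k V →ₐ[k] SymmetricAlgebra k V => F x) h1

/-- The representation of `G` on `⋀^n(V)` induced by a representation `ρ` on `V`: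
`g • (v₁ ∧ ⋯ ∧ vₙ) = (g • v₁) ∧ ⋯ ∧ (g • vₙ)`. -/
noncomputable def extPower (ρ : Representation k G V) (n : ℕ) :
    Representation k G (⋀[k]^n V) where
  toFun g := exteriorPower.map n (ρ g)
  map_one' := by
    rw [map_one, Module.End.one_eq_id, exteriorPower.map_id, Module.End.one_eq_id]
  map_mul' g h := by
    rw [map_mul, Module.End.mul_eq_comp, exteriorPower.map_comp, Module.End.mul_eq_comp]

end Representation

/-- The dimension over `ℂ` of the space of `G`-invariants (the isotypic component of the trivial
representation) in `S^a(R) ⊗ ⋀^b(R)`, where `R = ℂ[G]` is the regular representation of `G` and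
`G` acts diagonally. -/
noncomputable def dimInvariantsSymExt (G : Type*) [Group G] (a b : ℕ) : ℕ :=
  Module.finrank ℂ
    (Representation.invariants (k := ℂ) (G := G)
      (V := symPow ℂ a (MonoidAlgebra ℂ G) ⊗[ℂ] ⋀[ℂ]^b (MonoidAlgebra ℂ G))
      (((Representation.leftRegular ℂ G).symPower a).tprod
        ((Representation.leftRegular ℂ G).extPower b)))

/-!
The proof computes the characters of the symmetric and exterior powers of the regular
representation `ℂ[G]` of a finite group `G`, commutative or not.

The group elements form a basis of `ℂ[G]` which `G` permutes by left translation. Hence `g : G`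
permutes the monomial basis of `S^n(ℂ[G])`, and, up to sign, the basis of `⋀^n(ℂ[G])` formed by the
`n`-element subsets of `G`. A monomial or a subset fixed by `g` is a function `G → ℕ` that is
constant along the cosets of the cyclic group generated by `g`, so `orderOf g` divides its sum
(`orderOf_dvd_sum_of_mul_left_invariant`), which is `n`. Thus both traces of `g` vanish
unless `orderOf g ∣ n` (`trace_symPower_leftRegular_eq_zero`,
`trace_extPower_leftRegular_eq_zero`).

If `g` has a nonzero character on `S^a ⊗ ⋀^b`, then `orderOf g` divides `a`, `b` and `|G|`. When
these three numbers are coprime, only `g = 1` contributes to the average of the character, so the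
space of invariants has dimension `dim S^a * dim ⋀^b / |G|` (`card_mul_dimInvariantsSymExt`). For
`a = p`, `b = m` and `|G| = q + m` this is `(p + q + m - 1)! / (p! q! m!)`, which is symmetric in `p`
and `q`.
-/

open Module

/-! ### Functions invariant under translation -/

theorem orderOf_dvd_sum_of_mul_left_invariant {G : Type*} [Group G] [Fintype G] (g : G)
    (f : G → ℕ) (hf : ∀ x, f (g * x) = f x) : orderOf g ∣ ∑ x, f x := by
  classical
  have hpow : ∀ n : ℕ, ∀ x, f (g ^ n * x) = f x := by
    intro n
    induction n with
    | zero => simp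
    | succ n ih => intro x; rw [pow_succ', mul_assoc, hf, ih]
  -- Inversion turns left translations into right ones, whose orbits are left cosets.
  have hinv : ∀ x : G, ∀ h : Subgroup.zpowers g, f (x * h)⁻¹ = f x⁻¹ := by
    rintro x ⟨h, hh⟩
    obtain ⟨n, hn⟩ := (mem_powers_iff_mem_zpowers.mpr (inv_mem hh) : h⁻¹ ∈ Submonoid.powers g)
    rw [mul_inv_rev]
    simpa only [← hn] using hpow n x⁻¹
  obtain ⟨S, hS, -⟩ := (Subgroup.zpowers g).exists_isComplement_left 1
  rw [← Equiv.sum_comp (Equiv.inv G) f, ← Function.Bijective.sum_comp hS,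
    Fintype.sum_prod_type]
  refine Finset.dvd_sum fun c _ => ?_
  have hc : ∑ h : Subgroup.zpowers g, f (c * h)⁻¹ = orderOf g * f (c : G)⁻¹ := by
    rw [Finset.sum_congr rfl fun h _ => hinv c h, Finset.sum_const, Finset.card_univ,
      Fintype.card_zpowers, smul_eq_mul]
  exact Dvd.intro _ hc.symm

/-! ### Symmetric powers -/

theorem symPow_eq_span_monomials {κ R M : Type*} [CommRing R] [AddCommGroup M] [Module R M]
    (b : Basis κ R M) (n : ℕ) :
    Submodule.span R (Set.range fun d : {d : κ →₀ ℕ // d.degree = n} => b.symmetricAlgebra d) =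
      symPow R n M := by
  let e := SymmetricAlgebra.equivMvPolynomial b
  have h1 : LinearMap.range (SymmetricAlgebra.ι R M) =
      (MvPolynomial.homogeneousSubmodule κ R 1).map e.symm.toLinearMap := by
    rw [MvPolynomial.homogeneousSubmodule_one_eq_span_X, Submodule.map_span, ← Set.range_comp,
      LinearMap.range_eq_map, ← b.span_eq, Submodule.map_span, ← Set.range_comp]
    congr 2
    ext i
    simp [e]
  have h2 : symPow R n M =
      (MvPolynomial.homogeneousSubmodule κ R n).map e.symm.toLinearMap := by
    rw [symPow, h1, ← MvPolynomial.homogeneousSubmodule_one_pow (σ := κ) (R := R) n]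
    exact (Submodule.map_pow _ e.symm.toAlgHom n).symm
  rw [h2, MvPolynomial.homogeneousSubmodule_eq_finsupp_supported,
    AddMonoidAlgebra.supported_eq_span_single, Submodule.map_span, ← Set.image_comp,
    Set.image_eq_range]
  rfl

/-- The basis of `S^n(M)` formed by the monomials of degree `n` in the vectors of a basis
of `M`; a monomial is encoded by its exponents. -/
noncomputable def symPowBasis {κ R M : Type*} [CommRing R] [AddCommGroup M] [Module R M]
    (b : Basis κ R M) (n : ℕ) : Basis {d : κ →₀ ℕ // d.degree = n} R (symPow R n M) :=
  (Basis.span (b.symmetricAlgebra.linearIndependent.comp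
    (Subtype.val : {d : κ →₀ ℕ // d.degree = n} → κ →₀ ℕ) Subtype.val_injective)).map
    (LinearEquiv.ofEq _ _ (symPow_eq_span_monomials b n))

theorem coe_symPowBasis {κ R M : Type*} [CommRing R] [AddCommGroup M] [Module R M]
    (b : Basis κ R M) (n : ℕ) (d : {d : κ →₀ ℕ // d.degree = n}) :
    (symPowBasis b n d : SymmetricAlgebra R M) = b.symmetricAlgebra d := by
  simp [symPowBasis, Basis.span_apply]

theorem symmetricAlgebra_basis_eq_prod {κ R M : Type*} [CommRing R] [AddCommGroup M] [Module R M]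
    (b : Basis κ R M) (d : κ →₀ ℕ) :
    b.symmetricAlgebra d = d.prod fun i k => SymmetricAlgebra.ι R M (b i) ^ k := by
  rw [Basis.symmetricAlgebra, Basis.map_apply, MvPolynomial.coe_basisMonomials]
  beta_reduce
  rw [MvPolynomial.monomial_eq]
  simp [Finsupp.prod, -MvPolynomial.prod_X_pow_eq_monomial]

theorem symAlgMap_basis {κ R M : Type*} [CommRing R] [AddCommGroup M] [Module R M]
    (b : Basis κ R M) (f : M →ₗ[R] M) (σ : κ → κ) (hf : ∀ i, f (b i) = b (σ i)) (d : κ →₀ ℕ) :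
    symAlgMap f (b.symmetricAlgebra d) = b.symmetricAlgebra (d.mapDomain σ) := by
  rw [symmetricAlgebra_basis_eq_prod, symmetricAlgebra_basis_eq_prod,
    Finsupp.prod_mapDomain_index (by simp) (by intros; rw [pow_add])]
  simp [Finsupp.prod, map_prod, symAlgMap, hf]

theorem finite_symPow {R M : Type*} [CommRing R] [AddCommGroup M] [Module R M]
    [Module.Finite R M] (n : ℕ) : Module.Finite R (symPow R n M) := by
  rw [Module.Finite.iff_fg, symPow, LinearMap.range_eq_map]
  exact Submodule.FG.pow (Submodule.FG.map _ Module.Finite.fg_top) n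

theorem finrank_symPow {κ R M : Type*} [CommRing R] [Nontrivial R] [AddCommGroup M] [Module R M]
    (b : Basis κ R M) (n : ℕ) :
    finrank R (symPow R n M) = (Nat.card κ).multichoose n := by
  classical
  rw [finrank_eq_nat_card_basis (symPowBasis b n), ← Sym.natCard_sym_eq_multichoose]
  exact (Nat.card_congr (Sym.equivNatSum κ n)).symm

/-! ### Traces on powers of the regular representation -/

theorem trace_eq_zero_of_repr_self_eq_zero {ι R M : Type*} [CommRing R] [AddCommGroup M]
    [Module R M] [Finite ι] (b : Basis ι R M) (f : M →ₗ[R] M)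
    (h : ∀ i, b.repr (f (b i)) i = 0) : LinearMap.trace R M f = 0 := by
  classical
  cases nonempty_fintype ι
  rw [LinearMap.trace_eq_matrix_trace R b, Matrix.trace]
  exact Finset.sum_eq_zero fun i _ => by simp [LinearMap.toMatrix_apply, h]

theorem leftRegular_basis (k : Type*) [CommRing k] {G : Type*} [Group G] (g x : G) :
    Representation.leftRegular k G g (MonoidAlgebra.basis G k x) =
      MonoidAlgebra.basis G k (g * x) := by
  simp [Representation.ofMulAction_single]

theorem trace_symPower_leftRegular_eq_zero (k : Type*) [CommRing k] [Nontrivial k] {G : Type*}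
    [Group G] [Finite G] (g : G) (n : ℕ) (hn : ¬ orderOf g ∣ n) :
    LinearMap.trace k _ ((Representation.leftRegular k G).symPower n g) = 0 := by
  classical
  cases nonempty_fintype G
  let b := MonoidAlgebra.basis G k
  have := finite_symPow (R := k) (M := MonoidAlgebra k G) n
  have : Finite {d : G →₀ ℕ // d.degree = n} := Module.Finite.finite_basis (symPowBasis b n)
  refine trace_eq_zero_of_repr_self_eq_zero (symPowBasis b n) _ ?_
  rintro ⟨d, hd⟩
  have hd' : (d.mapDomain (g * ·)).degree = n := by rw [Finsupp.degree_mapDomain, hd]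
  have key : (Representation.leftRegular k G).symPower n g (symPowBasis b n ⟨d, hd⟩) =
      symPowBasis b n ⟨d.mapDomain (g * ·), hd'⟩ := by
    refine Subtype.ext ?_
    rw [coe_symPowBasis]
    refine Eq.trans ?_ (symAlgMap_basis b _ _ (leftRegular_basis k g) d)
    rw [← coe_symPowBasis b n ⟨d, hd⟩]
    rfl
  rw [key, Basis.repr_self]
  refine Finsupp.single_eq_of_ne fun h => hn ?_
  have h := congrArg Subtype.val h
  rw [← hd, Finsupp.degree_eq_sum]
  refine orderOf_dvd_sum_of_mul_left_invariant g d fun x => ?_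
  conv_lhs => rw [show d = d.mapDomain (g * ·) from h]
  exact Finsupp.mapDomain_apply (mul_right_injective g) d x

theorem trace_extPower_leftRegular_eq_zero (k : Type*) [CommRing k] {G : Type*}
    [Group G] [Finite G] (g : G) (n : ℕ) (hn : ¬ orderOf g ∣ n) :
    LinearMap.trace k _ ((Representation.leftRegular k G).extPower n g) = 0 := by
  classical
  cases nonempty_fintype G
  let : LinearOrder G := linearOrderOfSTO WellOrderingRel
  let b := MonoidAlgebra.basis G k
  refine trace_eq_zero_of_repr_self_eq_zero (b.exteriorPower n) _ fun s => ?_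
  have hmem : ∀ i, Set.powersetCard.ofFinEmbEquiv.symm s i ∈ (s : Finset G) := fun i =>
    (Set.powersetCard.mem_range_ofFinEmbEquiv_symm_iff_mem s _).mp ⟨i, rfl⟩
  rw [exteriorPower.basis_repr_apply, exteriorPower.basis_apply, exteriorPower.ιMulti_family]
  change exteriorPower.ιMultiDual k n b s (exteriorPower.map n _ _) = 0
  rw [exteriorPower.map_apply_ιMulti, exteriorPower.ιMultiDual_apply_ιMulti]
  -- As `g • s ≠ s`, some `x ∈ s` lies outside `g • s`; its column in the minor vanishes.
  obtain ⟨x, hx, hxg⟩ : ∃ x ∈ (s : Finset G), ∀ y ∈ (s : Finset G), g * y ≠ x := by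
    by_contra! hall
    refine hn ?_
    have himage : (s : Finset G).image (g * ·) = s := by
      refine (Finset.eq_of_subset_of_card_le (fun x hx => ?_)
        (Finset.card_image_le)).symm
      obtain ⟨y, hy, rfl⟩ := hall x hx
      exact Finset.mem_image_of_mem _ hy
    have hsum : ∑ x, (if x ∈ (s : Finset G) then 1 else 0) = n := by
      rw [Finset.sum_boole, Finset.filter_univ_mem, Nat.cast_id]
      exact s.2
    rw [← hsum]
    refine orderOf_dvd_sum_of_mul_left_invariant g _ fun x => ?_
    have : g * x ∈ (s : Finset G) ↔ x ∈ (s : Finset G) := by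
      conv_lhs => rw [← himage]
      simp
    simp only [this]
  obtain ⟨j, rfl⟩ := (Set.powersetCard.mem_range_ofFinEmbEquiv_symm_iff_mem s x).mpr hx
  refine Matrix.det_eq_zero_of_column_eq_zero j fun i => ?_
  rw [Matrix.of_apply, Function.comp_apply, Function.comp_apply, leftRegular_basis,
    Basis.coord_apply, Basis.repr_self]
  exact Finsupp.single_eq_of_ne (hxg _ (hmem i)).symm

/-! ### The dimension of the invariants -/

/-- A representation whose character vanishes away from `1` has the dimension of a multiple of the
regular representation; averaging the character counts the multiplicity. -/
theorem card_mul_finrank_invariants_eq_finrank {k G V : Type*} [Field k] [CharZero k] [Group G]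
    [Finite G] [AddCommGroup V] [Module k V] [FiniteDimensional k V] (ρ : Representation k G V)
    (h : ∀ g, g ≠ 1 → ρ.character g = 0) :
    Nat.card G * finrank k ρ.invariants = finrank k V := by
  cases nonempty_fintype G
  have hcard : (Nat.card G : k) ≠ 0 := by exact_mod_cast Nat.card_pos.ne'
  let := invertibleOfNonzero hcard
  have hsum := ρ.card_inv_mul_sum_char_eq_finrank
  rw [Finset.sum_eq_single 1 (fun g _ hg => h g hg) (by simp), Representation.char_one,
    inv_mul_eq_iff_eq_mul₀ hcard] at hsum
  exact_mod_cast hsum.symm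

theorem card_mul_dimInvariantsSymExt (G : Type*) [Group G] [Finite G] (a b : ℕ)
    (h : Nat.gcd (Nat.gcd a b) (Nat.card G) = 1) :
    Nat.card G * dimInvariantsSymExt G a b =
      (Nat.card G).multichoose a * (Nat.card G).choose b := by
  have := finite_symPow (R := ℂ) (M := MonoidAlgebra ℂ G) a
  have hdim := card_mul_finrank_invariants_eq_finrank
    (V := symPow ℂ a (MonoidAlgebra ℂ G) ⊗[ℂ] ⋀[ℂ]^b (MonoidAlgebra ℂ G))
    (((Representation.leftRegular ℂ G).symPower a).tprod
      ((Representation.leftRegular ℂ G).extPower b)) fun g hg => by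
    change LinearMap.trace ℂ _ (TensorProduct.map _ _) = 0
    rw [LinearMap.trace_tensorProduct']
    by_cases ha : orderOf g ∣ a
    · have hb : ¬ orderOf g ∣ b := fun hb => hg <| orderOf_eq_one_iff.mp <|
        Nat.dvd_one.mp <| h ▸ Nat.dvd_gcd (Nat.dvd_gcd ha hb) (orderOf_dvd_natCard g)
      rw [trace_extPower_leftRegular_eq_zero ℂ g b hb, mul_zero]
    · rw [trace_symPower_leftRegular_eq_zero ℂ g a ha, zero_mul]
  rw [finrank_tensorProduct, exteriorPower.finrank_eq,
    finrank_symPow (MonoidAlgebra.basis G ℂ),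
    finrank_eq_nat_card_basis (MonoidAlgebra.basis G ℂ)] at hdim
  exact hdim

theorem multichoose_mul_choose_mul_eq (p q m : ℕ) (h : 0 < q + m) :
    (p + q + m) * ((q + m).multichoose p * (q + m).choose m) =
      (q + m) * Nat.multinomial Finset.univ ![p, q, m] := by
  obtain ⟨n, hn⟩ : ∃ n, q + m = n + 1 := ⟨q + m - 1, by omega⟩
  have h1 : (n + p).choose p * p.factorial * n.factorial = (n + p).factorial := by
    have := Nat.choose_mul_factorial_mul_factorial (Nat.le_add_left p n)
    rwa [Nat.add_sub_cancel] at this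
  have h2 : (n + 1).choose m * m.factorial * q.factorial = (n + 1).factorial := by
    have := Nat.choose_mul_factorial_mul_factorial (Nat.le_add_left m q)
    rwa [Nat.add_sub_cancel, hn] at this
  have h3 : p.factorial * q.factorial * m.factorial * Nat.multinomial Finset.univ ![p, q, m] =
      (n + p + 1).factorial := by
    have := Nat.multinomial_spec Finset.univ ![p, q, m]
    rw [Fin.prod_univ_three, Fin.sum_univ_three] at this
    simpa [show p + q + m = n + p + 1 by omega] using this
  have hpos : 0 < p.factorial * q.factorial * m.factorial * n.factorial := by positivity
  refine Nat.eq_of_mul_eq_mul_left hpos ?_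
  rw [Nat.multichoose_eq, show q + m + p - 1 = n + p by omega,
    show p + q + m = n + p + 1 by omega]
  rw [Nat.factorial_succ] at h2 h3
  calc _ = (n + p + 1) * (((n + p).choose p * p.factorial * n.factorial) *
          ((n + 1).choose m * m.factorial * q.factorial)) := by rw [hn]; ring
    _ = n.factorial * (n + 1) * ((n + p + 1) * (n + p).factorial) := by rw [h1, h2]; ring
    _ = _ := by rw [← h3, hn]; ring

theorem dimInvariantsSymExt_eq (p q m : ℕ) (hgcd : Nat.gcd (Nat.gcd p q) m = 1)
    (G : Type*) [Group G] [Finite G] (hG : Nat.card G = q + m) :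
    (dimInvariantsSymExt G p m : ℚ) =
      1 / ((p : ℚ) + q + m) * (Nat.multinomial Finset.univ ![p, q, m] : ℚ) := by
  have hpos : 0 < q + m := hG ▸ Nat.card_pos
  have hcop : Nat.gcd (Nat.gcd p m) (Nat.card G) = 1 := by
    rw [hG, Nat.gcd_assoc, Nat.gcd_add_self_right, Nat.gcd_comm m, ← Nat.gcd_assoc, hgcd]
  have h1 := card_mul_dimInvariantsSymExt G p m hcop
  have h2 := multichoose_mul_choose_mul_eq p q m hpos
  rw [hG] at h1
  rw [← h1, mul_left_comm] at h2
  have h3 := Nat.eq_of_mul_eq_mul_left hpos h2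
  have hne : (p : ℚ) + q + m ≠ 0 := by
    have : p + q + m ≠ 0 := by omega
    exact_mod_cast this
  rw [one_div, eq_inv_mul_iff_mul_eq₀ hne]
  exact_mod_cast h3

theorem theorem1p3 (p q m : ℕ) (hgcd : Nat.gcd (Nat.gcd p q) m = 1)
    (G : Type*) [CommGroup G] [Finite G] (hG : Nat.card G = q + m)
    (H : Type*) [CommGroup H] [Finite H] (hH : Nat.card H = p + m) :
    dimInvariantsSymExt G p m = dimInvariantsSymExt H q m ∧
    (dimInvariantsSymExt G p m : ℚ) =
      1 / ((p : ℚ) + q + m) * (Nat.multinomial Finset.univ ![p, q, m] : ℚ) ∧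
    (dimInvariantsSymExt H q m : ℚ) =
      1 / ((p : ℚ) + q + m) * (Nat.multinomial Finset.univ ![p, q, m] : ℚ) := by
  have h1 := dimInvariantsSymExt_eq p q m hgcd G hG
  have h2 := dimInvariantsSymExt_eq q p m (by rwa [Nat.gcd_comm q p]) H hH
  have hswap : Nat.multinomial Finset.univ ![q, p, m] = Nat.multinomial Finset.univ ![p, q, m] := by
    rw [Nat.multinomial_univ_three, Nat.multinomial_univ_three, add_comm q p,
      mul_comm q.factorial]
  rw [hswap, add_comm (q : ℚ) p] at h2
  exact ⟨by exact_mod_cast h1.trans h2.symm, h1, h2⟩
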